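/- Let $n \ge 1$, let $\mathbb{R}^{2n}$ have coordinates $(x_1, y_1, \dots, x_n, y_n)$, and let $\omega_0 = dx_1 \wedge dy_1 + \dots + dx_n \wedge dy_n$ be the standard symplectic form. Let $L_1 = \{(0, \dots, 0, s, 0) \in \mathbb{R}^{2n} : s \ge 0\}$, that is, the ray on which $x_n = s \ge 0$ and all other coordinates vanish, and let $M_1 = \mathbb{R}^{2n} \setminus L_1$. Then $M_1$ is standard, i.e. $M_1$ is open and $(M_1, \omega_0|_{M_1})$ is symplectomorphic to $(\mathbb{R}^{2n}, \omega_0)$ by a smooth ($C^\infty$) symplectomorphism. Moreover, for every $\varepsilon > 0$ there is a smooth symplectomorphism $\varphi \colon (M_1, \omega_0|_{M_1}) \to (\mathbb{R}^{2n}, \omega_0)$ such that $\varphi(p) = p$ for every $p \in M_1$ outside of $\mathbb{B}^{2n-2}(\varepsilon) \times W(\varepsilon) \subset \mathbb{R}^{2n-2} \times \mathbb{R}^2 = \mathbb{R}^{2n}$, where $\mathbb{B}^{d}(\varepsilon)$ is the open Euclidean ball of radius $\varepsilon$ centered at the origin of $\mathbb{R}^{d}$ and $$W(\varepsilon) = \mathbb{B}^{2}(\varepsilon)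 \cup \Big\{(x, y) \in \mathbb{R}^2 : x > \tfrac{\sqrt{2}\,\varepsilon}{2},\ x|y| < \tfrac{\varepsilon^2}{2}\Big\}.$$ -/

import Mathlib

open scoped ContDiff

/-- The Euclidean space `ℝ²ⁿ` with coordinates `(x₁, y₁, …, xₙ, yₙ)`: the coordinate with index
`(i, 0)` is `xᵢ` and the coordinate with index `(i, 1)` is `yᵢ`. -/
abbrev PhaseSpace (n : ℕ) : Type := EuclideanSpace ℝ (Fin n × Fin 2)

/-- The standard symplectic form `ω₀ = dx₁ ∧ dy₁ + ⋯ + dxₙ ∧ dyₙ`, a constant 2-form on `ℝ²ⁿ`,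
evaluated on two tangent vectors. -/
noncomputable def omega0 {n : ℕ} (u v : PhaseSpace n) : ℝ :=
  ∑ i : Fin n, (u (i, 0) * v (i, 1) - u (i, 1) * v (i, 0))

/-- `φ` restricts to a symplectomorphism from `(A, ω₀|_A)` onto `(B, ω₀|_B)`, for open subsets
`A` and `B` of `ℝ²ⁿ`: it is a smooth bijection of `A` onto `B` with smooth inverse `ψ`, and the
pullback of `ω₀` along it is `ω₀`. Values of `φ` outside `A` play no role. -/
def IsSymplectomorphism {n : ℕ} (φ : PhaseSpace n → PhaseSpace n) (A B : Set (PhaseSpace n)) :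
    Prop :=
  IsOpen A ∧ IsOpen B ∧
  ContDiffOn ℝ ∞ φ A ∧
  (∃ ψ : PhaseSpace n → PhaseSpace n,
    Set.MapsTo φ A B ∧ Set.MapsTo ψ B A ∧ Set.InvOn ψ φ A B ∧ ContDiffOn ℝ ∞ ψ B) ∧
  ∀ x ∈ A, ∀ u v : PhaseSpace n, omega0 (fderiv ℝ φ x u) (fderiv ℝ φ x v) = omega0 u v

/-- An open subset `A` of `ℝ²ⁿ` is standard if `(A, ω₀|_A)` is symplectomorphic to `(ℝ²ⁿ, ω₀)`. -/
def IsStandard {n : ℕ} (A : Set (PhaseSpace n)) : Prop :=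
  IsOpen A ∧ ∃ φ : PhaseSpace n → PhaseSpace n, IsSymplectomorphism φ A Set.univ

/-- The parametrized ray `γ₀(s) = (0, …, 0, s, 0)` in `ℝ²ⁿ`, `n = m + 1`: the coordinate `xₙ` is
`s` and all others vanish. -/
noncomputable def gamma0 (m : ℕ) (s : ℝ) : PhaseSpace (m + 1) :=
  EuclideanSpace.single (Fin.last m, 0) s

/-- The ray `L₁`, the image of `[0, ∞)` under `γ₀`. -/
def rayL1 (m : ℕ) : Set (PhaseSpace (m + 1)) := gamma0 m '' Set.Ici 0

/-- `M₁ = ℝ²ⁿ ∖ L₁`. -/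
def spaceM1 (m : ℕ) : Set (PhaseSpace (m + 1)) := (rayL1 m)ᶜ

/-- `W(ε) = 𝔹²(ε) ∪ {(x, y) | x > √2 ε / 2, x |y| < ε² / 2}` in `ℝ²`. -/
def regionW (ε : ℝ) : Set (EuclideanSpace ℝ (Fin 2)) :=
  Metric.ball 0 ε ∪ {p | p 0 > Real.sqrt 2 * ε / 2 ∧ p 0 * |p 1| < ε ^ 2 / 2}

/-- The first `2n - 2` coordinates `(x₁, y₁, …, xₙ₋₁, yₙ₋₁)` of a point, `n = m + 1`. -/
noncomputable def initCoords {m : ℕ} (p : PhaseSpace (m + 1)) : PhaseSpace m :=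
  WithLp.toLp 2 fun k => p (k.1.castSucc, k.2)

/-- The last two coordinates `(xₙ, yₙ)` of a point, `n = m + 1`. -/
noncomputable def lastCoords {m : ℕ} (p : PhaseSpace (m + 1)) : EuclideanSpace ℝ (Fin 2) :=
  WithLp.toLp 2 fun j => p (Fin.last m, j)

/-- The neighbourhood `𝔹²ⁿ⁻²(ε) × W(ε)` of the ray in `ℝ²ⁿ⁻² × ℝ² = ℝ²ⁿ`, `n = m + 1`. -/
def rayNbhd (m : ℕ) (ε : ℝ) : Set (PhaseSpace (m + 1)) :=
  {p | initCoords p ∈ Metric.ball (0 : PhaseSpace m) ε ∧ lastCoords p ∈ regionW ε}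

/-! The ray is pushed off to infinity by an infinite composition of symplectomorphisms of `ℝ²ⁿ`,
each supported in a bounded neighbourhood of a segment of the `xₙ`-axis and preserving that axis.
Let `S j` be the partial products. Passing from `S j` to `S (j + 1)` changes nothing outside the
`1/(j+1)`-neighbourhood of the ray, so near a point off the ray the sequence is eventually constant.
It changes the inverse only over `xₙ > (S j).axis 0 - 1`, and `(S j).axis 0 ≥ j`, so the inverses
also stabilize locally, on all of `ℝ²ⁿ`. The two limits are mutually inverse symplectomorphisms
between `M₁` and `ℝ²ⁿ` (`exists_symplectomorphism_spaceM1`). Of `rayNbhd` only openness and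
containing the ray matter.

No flow is integrated: a single push is the Cayley transform `(id + X) ∘ (id - X)⁻¹` of a small
Hamiltonian field `X` (`exists_symplectic_cayley`), with Hamiltonian a multiple of `χ yₙ` for a
cutoff `χ`. On the axis this `X` is a multiple of `∂/∂xₙ`. -/

open Set Filter Topology

/-! ### Perturbations of the identity. -/

/-- A small Lipschitz smooth perturbation of the identity of a Banach space is a diffeomorphism. -/
theorem exists_homeomorph_id_add {E : Type*} [NormedAddCommGroup E] [NormedSpace ℝ E]
    [CompleteSpace E] {X : E → E} {K : NNReal} (hX : LipschitzWith K X) (hK : K < 1)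
    (hs : ContDiff ℝ ∞ X) :
    ∃ e : E ≃ₜ E, (∀ x, e x = x + X x) ∧ ContDiff ℝ ∞ e.symm := by
  have happ : ApproximatesLinearOn (fun x => x + X x)
      ((ContinuousLinearEquiv.refl ℝ E : E ≃L[ℝ] E) : E →L[ℝ] E) univ K := by
    intro x _ y _
    have h := hX.dist_le_mul x y
    rw [dist_eq_norm, dist_eq_norm] at h
    simpa [add_sub_add_comm] using h
  have hc : Subsingleton E ∨ K < ‖((ContinuousLinearEquiv.refl ℝ E).symm : E →L[ℝ] E)‖₊⁻¹ := by
    rcases subsingleton_or_nontrivial E with h | h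
    · exact Or.inl h
    · right
      have : ‖((ContinuousLinearEquiv.refl ℝ E).symm : E →L[ℝ] E)‖₊ = 1 := by
        simp
      rw [this, inv_one]
      exact hK
  have hlt : ∀ a, ‖-fderiv ℝ X a‖ < 1 := fun a => by
    rw [norm_neg]
    exact (norm_fderiv_le_of_lipschitz ℝ hX).trans_lt (by exact_mod_cast hK)
  refine ⟨happ.toHomeomorph _ hc, fun x => rfl, ?_⟩
  -- The derivative `1 + DX` is invertible by the Neumann series, since `‖DX‖ ≤ K < 1`.
  refine Homeomorph.contDiff_symm (𝕜 := ℝ) _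
    (f₀' := fun a => ContinuousLinearEquiv.ofUnit (Units.oneSub (-fderiv ℝ X a) (hlt a))) ?_ ?_
  · intro a
    have h := (hasFDerivAt_id (𝕜 := ℝ) a).add
      ((hs.differentiable (by simp)).differentiableAt (x := a)).hasFDerivAt
    refine h.congr_fderiv ?_
    ext v
    change v + fderiv ℝ X a v = ((1 : E →L[ℝ] E) - (-fderiv ℝ X a)) v
    simp
  · exact contDiff_id.add hs

/-! ### Linear symplectic algebra, Cayley transforms and Hamiltonian fields. -/

section Symplectic

variable {n : ℕ}

theorem omega0_add_left (u v w : PhaseSpace n) : omega0 (u + v) w = omega0 u w + omega0 v w := by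
  simp only [omega0, PiLp.add_apply, ← Finset.sum_add_distrib]
  exact Finset.sum_congr rfl fun i _ => by ring

theorem omega0_smul_left (c : ℝ) (u v : PhaseSpace n) : omega0 (c • u) v = c * omega0 u v := by
  simp only [omega0, PiLp.smul_apply, smul_eq_mul, Finset.mul_sum]
  exact Finset.sum_congr rfl fun i _ => by ring

theorem omega0_swap (u v : PhaseSpace n) : omega0 u v = -omega0 v u := by
  simp only [omega0, ← Finset.sum_neg_distrib]
  exact Finset.sum_congr rfl fun i _ => by ring

theorem omega0_add_right (u v w : PhaseSpace n) : omega0 u (v + w) = omega0 u v + omega0 u w := by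
  rw [omega0_swap, omega0_add_left, omega0_swap v, omega0_swap w]; ring

theorem omega0_neg_left (u v : PhaseSpace n) : omega0 (-u) v = -omega0 u v := by
  rw [← neg_one_smul ℝ u, omega0_smul_left]; ring

theorem omega0_neg_right (u v : PhaseSpace n) : omega0 u (-v) = -omega0 u v := by
  rw [omega0_swap, omega0_neg_left, omega0_swap v, neg_neg]

/-- A global smooth symplectomorphism of `ℝ²ⁿ`. -/
structure IsSymplecticPerm (e : Equiv.Perm (PhaseSpace n)) : Prop where
  contDiff : ContDiff ℝ ∞ e
  contDiff_symm : ContDiff ℝ ∞ e.symm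
  omega0_fderiv : ∀ x u v, omega0 (fderiv ℝ e x u) (fderiv ℝ e x v) = omega0 u v

theorem IsSymplecticPerm.one : IsSymplecticPerm (1 : Equiv.Perm (PhaseSpace n)) := by
  refine ⟨contDiff_id, contDiff_id, fun x u v => ?_⟩
  rw [Equiv.Perm.coe_one, fderiv_id]
  rfl

theorem IsSymplecticPerm.mul {e f : Equiv.Perm (PhaseSpace n)} (he : IsSymplecticPerm e)
    (hf : IsSymplecticPerm f) : IsSymplecticPerm (e * f) := by
  refine ⟨he.contDiff.comp hf.contDiff, hf.contDiff_symm.comp he.contDiff_symm, fun x u v => ?_⟩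
  rw [Equiv.Perm.coe_mul, fderiv_comp x (he.contDiff.differentiable (by simp)).differentiableAt
    (hf.contDiff.differentiable (by simp)).differentiableAt]
  simp only [ContinuousLinearMap.comp_apply, he.omega0_fderiv, hf.omega0_fderiv]

/-- The Cayley transform of an infinitesimally symplectic vector field. -/
theorem exists_symplectic_cayley {X : PhaseSpace n → PhaseSpace n} {K : NNReal}
    (hX : LipschitzWith K X) (hK : K < 1) (hs : ContDiff ℝ ∞ X)
    (hω : ∀ x u v, omega0 (fderiv ℝ X x u) v = -omega0 u (fderiv ℝ X x v)) :
    ∃ e : Equiv.Perm (PhaseSpace n), IsSymplecticPerm e ∧ ∀ u, e (u - X u) = u + X u := by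
  obtain ⟨B, hB, hBs⟩ := exists_homeomorph_id_add hX hK hs
  obtain ⟨A, hA, hAs⟩ := exists_homeomorph_id_add (X := fun x => -X x) hX.neg hK hs.neg
  have hXd : Differentiable ℝ X := hs.differentiable (by simp)
  have hBc : ContDiff ℝ ∞ B := by
    rw [funext hB]; exact contDiff_id.add hs
  have hAc : ContDiff ℝ ∞ A := by
    rw [funext hA]; exact contDiff_id.add hs.neg
  have hBd : ∀ x v, fderiv ℝ B x v = v + fderiv ℝ X x v := fun x v => by
    have : HasFDerivAt B (ContinuousLinearMap.id ℝ _ + fderiv ℝ X x) x :=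
      ((hasFDerivAt_id x).add (hXd x).hasFDerivAt).congr_of_eventuallyEq (.of_forall hB)
    rw [this.fderiv]; rfl
  have hAd : ∀ x v, fderiv ℝ A x v = v + -fderiv ℝ X x v := fun x v => by
    have : HasFDerivAt A (ContinuousLinearMap.id ℝ _ + -fderiv ℝ X x) x :=
      ((hasFDerivAt_id x).add (hXd x).hasFDerivAt.neg).congr_of_eventuallyEq (.of_forall hA)
    rw [this.fderiv]; rfl
  refine ⟨A.symm.toEquiv.trans B.toEquiv, ⟨hBc.comp hAs, hAc.comp ?_, fun x u v => ?_⟩, fun u => ?_⟩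
  · exact hBs
  · have hAsd := (hAs.differentiable (by simp)).differentiableAt (x := x)
    have h1 : ∀ w, fderiv ℝ (A.symm.toEquiv.trans B.toEquiv) x w
        = fderiv ℝ B (A.symm x) (fderiv ℝ A.symm x w) := fun w => by
      change fderiv ℝ (B ∘ A.symm) x w = _
      rw [fderiv_comp x (hBc.differentiable (by simp)).differentiableAt hAsd]
      rfl
    have h2 : ∀ w, fderiv ℝ A (A.symm x) (fderiv ℝ A.symm x w) = w := fun w => by
      rw [← ContinuousLinearMap.comp_apply, ← fderiv_comp x
        (hAc.differentiable (by simp)).differentiableAt hAsd]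
      have : A ∘ A.symm = id := by ext1 y; simp
      rw [this, fderiv_id]; rfl
    -- With `u = (1 - DX) a` and `v = (1 - DX) b`, both sides equal `ω₀(a, b) + ω₀(DX a, DX b)`: the
    -- cross terms cancel by `hω`.
    rw [h1, h1]
    conv_rhs => rw [← h2 u, ← h2 v]
    simp only [hBd, hAd, omega0_add_left, omega0_add_right, omega0_neg_left, omega0_neg_right, hω]
    ring
  · have : A u = u - X u := by rw [hA, sub_eq_add_neg]
    change B (A.symm (u - X u)) = _
    rw [← this, A.symm_apply_apply, hB]

/-- The linear map turning a covector `α` into the vector `w` with `ω₀(w, ·) = α`. -/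
noncomputable def omegaSharp : (PhaseSpace n →L[ℝ] ℝ) →L[ℝ] PhaseSpace n :=
  LinearMap.toContinuousLinearMap
    { toFun := fun α => WithLp.toLp 2 fun k =>
        if k.2 = 0 then α (EuclideanSpace.single (k.1, 1) 1)
        else -α (EuclideanSpace.single (k.1, 0) 1)
      map_add' := fun α β => by
        ext k
        by_cases h : k.2 = 0 <;> simp [h, add_comm]
      map_smul' := fun c α => by
        ext k
        by_cases h : k.2 = 0 <;> simp [h] }

theorem omegaSharp_apply (α : PhaseSpace n →L[ℝ] ℝ) (k : Fin n × Fin 2) :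
    omegaSharp α k = if k.2 = 0 then α (EuclideanSpace.single (k.1, 1) 1)
      else -α (EuclideanSpace.single (k.1, 0) 1) := rfl

theorem omega0_omegaSharp (α : PhaseSpace n →L[ℝ] ℝ) (v : PhaseSpace n) :
    omega0 (omegaSharp α) v = α v := by
  have hv : v = ∑ k, v k • (EuclideanSpace.single k 1 : PhaseSpace n) := by
    ext k
    simp [Finset.sum_apply, Pi.single_apply]
  conv_rhs => rw [hv]
  rw [map_sum, Fintype.sum_prod_type]
  refine Finset.sum_congr rfl fun i _ => ?_
  simp only [omegaSharp_apply, Fin.sum_univ_two, map_smul, smul_eq_mul]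
  norm_num
  ring

/-- The Hamiltonian vector field of `H`. -/
noncomputable def hamiltonianField (H : PhaseSpace n → ℝ) (p : PhaseSpace n) : PhaseSpace n :=
  omegaSharp (fderiv ℝ H p)

theorem contDiff_hamiltonianField {H : PhaseSpace n → ℝ} (hH : ContDiff ℝ ∞ H) :
    ContDiff ℝ ∞ (hamiltonianField H) :=
  omegaSharp.contDiff.comp (hH.fderiv_right (m := ∞) (by simp))

/-- Through `omegaSharp` this is the symmetry of the second derivative of `H`. -/
theorem omega0_fderiv_hamiltonianField {H : PhaseSpace n → ℝ} (hH : ContDiff ℝ ∞ H)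
    (x u v : PhaseSpace n) :
    omega0 (fderiv ℝ (hamiltonianField H) x u) v
      = -omega0 u (fderiv ℝ (hamiltonianField H) x v) := by
  have hd : DifferentiableAt ℝ (fderiv ℝ H) x :=
    ((hH.fderiv_right (m := ∞) (by simp)).differentiable (by simp)).differentiableAt
  have h : ∀ w, fderiv ℝ (hamiltonianField H) x w = omegaSharp (fderiv ℝ (fderiv ℝ H) x w) :=
    fun w => by
      have := (omegaSharp (n := n)).hasFDerivAt.comp x hd.hasFDerivAt
      change fderiv ℝ (omegaSharp ∘ fderiv ℝ H) x w = _
      rw [this.fderiv]; rfl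
  have hsymm : IsSymmSndFDerivAt ℝ H x :=
    hH.contDiffAt.isSymmSndFDerivAt (by
      rw [minSmoothness_of_isRCLikeNormedField]
      exact WithTop.coe_le_coe.2 (le_top : (2 : ℕ∞) ≤ ⊤))
  rw [h, h, omega0_swap u, neg_neg, omega0_omegaSharp, omega0_omegaSharp]
  exact hsymm.eq u v

end Symplectic

/-! ### Pushing along the `xₙ`-axis. -/

section Axis

variable {m : ℕ}

theorem gamma0_add (s t : ℝ) : gamma0 m (s + t) = gamma0 m s + gamma0 m t :=
  PiLp.single_add 2 _

theorem gamma0_sub (s t : ℝ) : gamma0 m (s - t) = gamma0 m s - gamma0 m t :=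
  PiLp.single_sub 2 _

theorem dist_gamma0 (s t : ℝ) : dist (gamma0 m s) (gamma0 m t) = dist s t :=
  PiLp.dist_single_same 2 _ _ _ _

theorem isometry_gamma0 : Isometry (gamma0 m) := Isometry.of_dist_eq dist_gamma0

@[simp] theorem gamma0_last_zero (s : ℝ) : gamma0 m s (Fin.last m, 0) = s := by
  simp [gamma0]

@[simp] theorem gamma0_last_one (s : ℝ) : gamma0 m s (Fin.last m, 1) = 0 := by
  simp [gamma0]

theorem contDiff_gamma0 : ContDiff ℝ ∞ (gamma0 m) := by
  have : gamma0 m = fun s : ℝ => s • gamma0 m 1 := by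
    ext s k
    by_cases h : k = (Fin.last m, 0)
    · subst h; simp
    · simp [gamma0, h]
  rw [this]
  exact contDiff_id.smul contDiff_const

theorem contDiff_coord {n : ℕ} (k : Fin n × Fin 2) :
    ContDiff ℝ ∞ fun p : PhaseSpace n => p k :=
  (EuclideanSpace.proj k : PhaseSpace n →L[ℝ] ℝ).contDiff

theorem omegaSharp_proj_last : omegaSharp (EuclideanSpace.proj (Fin.last m, 1)) = gamma0 m 1 := by
  ext ⟨i, j⟩
  fin_cases j
  · simp [omegaSharp_apply, gamma0, eq_comm]
  · simp [omegaSharp_apply, gamma0]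

/-- The vector field of the Hamiltonian `χ yₙ`. -/
theorem hamiltonianField_mul_coord {χ : PhaseSpace (m + 1) → ℝ} (hχ : ContDiff ℝ ∞ χ)
    (p : PhaseSpace (m + 1)) :
    hamiltonianField (fun q => χ q * q (Fin.last m, 1)) p
      = χ p • gamma0 m 1 + p (Fin.last m, 1) • omegaSharp (fderiv ℝ χ p) := by
  have h := ((hχ.differentiable (by simp)) p).hasFDerivAt.mul
    (EuclideanSpace.proj (Fin.last m, 1) : PhaseSpace (m + 1) →L[ℝ] ℝ).hasFDerivAt
  have h' : fderiv ℝ (fun q : PhaseSpace (m + 1) => χ q * q (Fin.last m, 1)) p = _ := h.fderiv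
  rw [hamiltonianField, h', map_add, map_smul, map_smul, omegaSharp_proj_last]
  rfl

/-- A symplectomorphism supported in a bounded neighbourhood `U` of the segment `[a, b]` of the
`xₙ`-axis, which preserves the axis and pushes points of the segment forward by a definite
amount. -/
theorem exists_symplectic_step {U : Set (PhaseSpace (m + 1))} (hU : IsOpen U)
    (hUb : Bornology.IsBounded U) {a b : ℝ} (hab : gamma0 m '' Icc a b ⊆ U) :
    ∃ t : ℝ, 0 < t ∧ ∃ e : Equiv.Perm (PhaseSpace (m + 1)), IsSymplecticPerm e ∧
      (∀ p ∉ U, e p = p) ∧ ∃ g : ℝ ≃o ℝ, (∀ s, e (gamma0 m s) = gamma0 m (g s)) ∧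
        ∀ s, a ≤ s → min (s + t) b ≤ g s := by
  obtain ⟨χ₀, h1, h0, hχ01⟩ := exists_contMDiffMap_one_nhds_of_subset_interior
    (n := (⊤ : ℕ∞)) (modelWithCornersSelf ℝ (PhaseSpace (m + 1)))
    ((isCompact_Icc (a := a) (b := b)).image isometry_gamma0.continuous).isClosed
    (hU.interior_eq.symm ▸ hab)
  obtain ⟨χ, hχ, hχ1, hχ0, hχn⟩ : ∃ χ : PhaseSpace (m + 1) → ℝ, ContDiff ℝ ∞ χ ∧
      (∀ s ∈ Icc a b, χ (gamma0 m s) = 1) ∧ (∀ p ∉ U, χ p = 0) ∧ ∀ p, 0 ≤ χ p :=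
    ⟨χ₀, χ₀.contMDiff.contDiff, fun s hs => h1.self_of_nhdsSet _ (mem_image_of_mem _ hs), h0,
      fun p => (hχ01 p).1⟩
  set X₀ := hamiltonianField (fun q => χ q * q (Fin.last m, 1)) with hX₀
  have hX₀s : ContDiff ℝ ∞ X₀ := contDiff_hamiltonianField (hχ.mul (contDiff_coord _))
  -- A zero of `χ ≥ 0` is a minimum, so `dχ` vanishes there too; hence `X₀` vanishes off `U` itself,
  -- not merely off its closure.
  have hX₀U : ∀ p ∉ U, X₀ p = 0 := fun p hp => by
    have hmin : IsLocalMin χ p := .of_forall fun q => by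
      simp only [hχ0 p hp, hχn q]
    rw [hX₀, hamiltonianField_mul_coord hχ, hmin.fderiv_eq_zero, hχ0 p hp]
    simp
  have hX₀γ : ∀ s, X₀ (gamma0 m s) = χ (gamma0 m s) • gamma0 m 1 := fun s => by
    rw [hX₀, hamiltonianField_mul_coord hχ]
    simp
  obtain ⟨C, hC⟩ := ContDiff.lipschitzWith_of_hasCompactSupport (𝕂 := ℝ)
    (HasCompactSupport.intro hUb.isCompact_closure fun p hp => hX₀U p fun h =>
      hp (subset_closure h)) hX₀s (by simp)
  obtain ⟨c, hc, hcK⟩ : ∃ c : NNReal, 0 < c ∧ c * C < 1 := by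
    refine ⟨(C + 1)⁻¹, by positivity, ?_⟩
    rw [inv_mul_lt_iff₀ (by positivity), mul_one]
    exact lt_add_one C
  set X : PhaseSpace (m + 1) → PhaseSpace (m + 1) := fun p => (c : ℝ) • X₀ p with hXdef
  have hXs : ContDiff ℝ ∞ X := hX₀s.const_smul (c : ℝ)
  have hXL : LipschitzWith (c * C) X := by
    refine LipschitzWith.of_dist_le_mul fun x y => ?_
    rw [hXdef, dist_smul₀, NNReal.coe_mul, mul_assoc]
    simpa using mul_le_mul_of_nonneg_left (hC.dist_le_mul x y) c.2
  have hXω : ∀ x u v, omega0 (fderiv ℝ X x u) v = -omega0 u (fderiv ℝ X x v) := fun x u v => by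
    have hd : fderiv ℝ X x = (c : ℝ) • fderiv ℝ X₀ x :=
      fderiv_fun_const_smul (hX₀s.differentiable (by simp)).differentiableAt _
    rw [hd, smul_apply, smul_apply, omega0_smul_left,
      omega0_swap u, omega0_smul_left,
      omega0_fderiv_hamiltonianField (hχ.mul (contDiff_coord _)), omega0_swap u]
    ring
  obtain ⟨e, he, heX⟩ := exists_symplectic_cayley hXL hcK hXs hXω
  -- On the axis `e` becomes the one-dimensional Cayley transform sending `u - f u` to `u + f u`.
  set f : ℝ → ℝ := fun s => c * χ (gamma0 m s) with hf
  have hXγ : ∀ s, X (gamma0 m s) = gamma0 m (f s) := fun s => by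
    rw [hXdef]
    simp only [hX₀γ]
    ext k
    by_cases h : k = (Fin.last m, 0)
    · subst h; simp [hf]
    · simp [gamma0, h]
  have hfs : ContDiff ℝ ∞ f := contDiff_const.mul (hχ.comp contDiff_gamma0)
  have hfL : LipschitzWith (c * C) f := LipschitzWith.of_dist_le_mul fun s s' => by
    rw [← dist_gamma0 (m := m), ← hXγ, ← hXγ, ← dist_gamma0 (m := m) s s']
    exact hXL.dist_le_mul _ _
  have hfn : ∀ s, 0 ≤ f s := fun s => mul_nonneg c.2 (hχn _)
  have hfd : ∀ s s', s < s' → |f s - f s'| < s' - s := fun s s' h => by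
    have h1 := hfL.dist_le_mul s s'
    rw [Real.dist_eq, dist_comm s, Real.dist_eq, abs_of_pos (sub_pos.2 h)] at h1
    have h2 : ((c * C : NNReal) : ℝ) < 1 := by exact_mod_cast hcK
    nlinarith
  obtain ⟨B, hB, -⟩ := exists_homeomorph_id_add hfL hcK hfs
  obtain ⟨A, hA, -⟩ := exists_homeomorph_id_add (X := fun s => -f s) hfL.neg hcK hfs.neg
  have hBm : StrictMono B := fun s s' h => by
    have := abs_lt.1 (hfd s s' h)
    rw [hB, hB]; linarith
  have hAm : StrictMono A := fun s s' h => by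
    have := abs_lt.1 (hfd s s' h)
    rw [hA, hA]; linarith
  refine ⟨c, by exact_mod_cast hc, e, he, fun p hp => ?_,
    (hAm.orderIsoOfSurjective _ A.surjective).symm.trans (hBm.orderIsoOfSurjective _ B.surjective),
    fun s => ?_, fun s hs => ?_⟩
  · have := heX p
    simpa [hXdef, hX₀U p hp] using this
  · obtain ⟨u, rfl⟩ := A.surjective s
    have hu := hAm.orderIsoOfSurjective_symm_apply_self _ A.surjective u
    rw [OrderIso.trans_apply, hu, StrictMono.coe_orderIsoOfSurjective, hA, hB, ← sub_eq_add_neg,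
      gamma0_sub, gamma0_add, ← hXγ]
    exact heX _
  · obtain ⟨u, rfl⟩ := A.surjective s
    have hu := hAm.orderIsoOfSurjective_symm_apply_self _ A.surjective u
    rw [OrderIso.trans_apply, hu, StrictMono.coe_orderIsoOfSurjective, hB]
    rw [hA] at hs ⊢
    have hfu := hfn u
    -- For `u ≤ b` the point moves by `2c`, more than the required `t = c`; for `u > b` its image is
    -- already beyond `b`.
    rcases le_or_gt u b with hub | hub
    · have : f u = c := by simp [hf, hχ1 u ⟨by linarith, hub⟩]
      exact min_le_of_left_le (by linarith)
    · exact min_le_of_right_le (by linarith)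

/-- A symplectomorphism supported in a neighbourhood `U` of the segment `[a, b]` of the `xₙ`-axis,
which preserves the axis and moves `a` beyond `b`. -/
theorem exists_symplectic_push {U : Set (PhaseSpace (m + 1))} (hU : IsOpen U)
    {a b : ℝ} (hle : a ≤ b) (hab : gamma0 m '' Icc a b ⊆ U) :
    ∃ e : Equiv.Perm (PhaseSpace (m + 1)), IsSymplecticPerm e ∧
      (∀ p ∉ U, e p = p) ∧ ∃ g : ℝ ≃o ℝ, (∀ s, e (gamma0 m s) = gamma0 m (g s)) ∧ b ≤ g a := by
  have hK : IsCompact (gamma0 m '' Icc a b) := isCompact_Icc.image isometry_gamma0.continuous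
  obtain ⟨R, hR⟩ := hK.isBounded.subset_ball 0
  obtain ⟨t, ht, e, he, heU, g, heg, hg⟩ := exists_symplectic_step (hU.inter Metric.isOpen_ball)
    (Metric.isBounded_ball.subset inter_subset_right) (subset_inter hab hR)
  -- Iterates of the step; `a ≤ g a` is carried along because the step estimate holds only for
  -- points beyond `a`.
  have key : ∀ N : ℕ, ∃ e : Equiv.Perm (PhaseSpace (m + 1)), IsSymplecticPerm e ∧
      (∀ p ∉ U, e p = p) ∧ ∃ g : ℝ ≃o ℝ, (∀ s, e (gamma0 m s) = gamma0 m (g s)) ∧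
        min (a + N * t) b ≤ g a ∧ a ≤ g a := by
    intro N
    induction N with
    | zero => exact ⟨1, .one, fun _ _ => rfl, OrderIso.refl ℝ, fun _ => rfl, by simp, le_rfl⟩
    | succ N ih =>
      obtain ⟨e', he', heU', g', heg', hg', hag'⟩ := ih
      refine ⟨e * e', he.mul he', fun p hp => ?_, g'.trans g, fun s => ?_, ?_, ?_⟩
      · rw [Equiv.Perm.mul_apply, heU' p hp, heU p fun h => hp h.1]
      · rw [Equiv.Perm.mul_apply, heg', heg]; rfl
      · refine le_trans ?_ (hg (g' a) hag')
        push_cast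
        rcases min_le_iff.1 hg' with h' | h'
        · exact min_le_min_right _ (by linarith)
        · exact le_min (min_le_of_right_le (by linarith)) (min_le_right _ _)
      · exact (le_min (hag'.trans (le_add_of_nonneg_right ht.le)) hle).trans (hg _ hag')
  obtain ⟨N, hN⟩ := exists_nat_ge ((b - a) / t)
  obtain ⟨e', he', heU', g', heg', hg', -⟩ := key N
  refine ⟨e', he', heU', g', heg', ?_⟩
  rw [div_le_iff₀ ht] at hN
  rwa [min_eq_right (by linarith)] at hg'

end Axis

/-! ### Excision of the ray as a limit of pushes. -/

section Excision

variable {m : ℕ}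

theorem isClosed_rayL1 : IsClosed (rayL1 m) :=
  isometry_gamma0.isClosedEmbedding.isClosedMap _ isClosed_Ici

theorem isOpen_spaceM1 : IsOpen (spaceM1 m) := isClosed_rayL1.isOpen_compl

theorem isOpen_regionW (ε : ℝ) : IsOpen (regionW ε) := by
  have h1 : IsOpen {p : EuclideanSpace ℝ (Fin 2) | p 0 > Real.sqrt 2 * ε / 2} :=
    isOpen_lt (by fun_prop) (by fun_prop)
  have h2 : IsOpen {p : EuclideanSpace ℝ (Fin 2) | p 0 * |p 1| < ε ^ 2 / 2} :=
    isOpen_lt (by fun_prop) (by fun_prop)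
  exact Metric.isOpen_ball.union (h1.inter h2)

theorem isOpen_rayNbhd (ε : ℝ) : IsOpen (rayNbhd m ε) := by
  have h1 : Continuous (initCoords (m := m)) := by
    unfold initCoords; fun_prop
  have h2 : Continuous (lastCoords (m := m)) := by
    unfold lastCoords; fun_prop
  exact (Metric.isOpen_ball.preimage h1).inter ((isOpen_regionW ε).preimage h2)

theorem rayL1_subset_rayNbhd {ε : ℝ} (hε : 0 < ε) : rayL1 m ⊆ rayNbhd m ε := by
  rintro _ ⟨s, hs : 0 ≤ s, rfl⟩
  have h1 : initCoords (gamma0 m s) = 0 := by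
    ext ⟨i, j⟩
    simp [initCoords, gamma0]
  have h2 : lastCoords (gamma0 m s) = EuclideanSpace.single 0 s := by
    ext j
    fin_cases j <;> simp [lastCoords, gamma0]
  refine ⟨by simp [h1, hε], ?_⟩
  rw [h2]
  rcases lt_or_ge s ε with h | h
  · left
    simpa [abs_of_nonneg hs] using h
  · right
    have : Real.sqrt 2 < 2 := by
      rw [Real.sqrt_lt' (by norm_num)]; norm_num
    refine ⟨?_, by simp; positivity⟩
    simp only [PiLp.single_eq_same]
    nlinarith

/-- A symplectomorphism of `ℝ²ⁿ` supported in `O` which restricts to an increasing homeomorphism of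
the `xₙ`-axis that moves the origin forward. -/
structure AxisSymplectomorphism (O : Set (PhaseSpace (m + 1))) where
  toPerm : Equiv.Perm (PhaseSpace (m + 1))
  symplectic : IsSymplecticPerm toPerm
  apply_of_notMem : ∀ p ∉ O, toPerm p = p
  axis : ℝ ≃o ℝ
  apply_gamma0 : ∀ s, toPerm (gamma0 m s) = gamma0 m (axis s)
  axis_zero_nonneg : 0 ≤ axis 0

/-- Postcomposition with a symplectomorphism supported far out near the image of the ray. -/
theorem AxisSymplectomorphism.exists_next {O V : Set (PhaseSpace (m + 1))} (hO : IsOpen O)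
    (hLO : rayL1 m ⊆ O) (hV : IsOpen V) (hLV : rayL1 m ⊆ V) (S : AxisSymplectomorphism O) :
    ∃ T : AxisSymplectomorphism O, S.axis 0 + 1 ≤ T.axis 0 ∧
      (∀ p ∉ V, T.toPerm p = S.toPerm p) ∧
      ∀ q, q (Fin.last m, 0) ≤ S.axis 0 - 1 → T.toPerm.symm q = S.toPerm.symm q := by
  -- The three factors of the support serve in turn: support in `O`; support in `S(V)`, so that `e ∘
  -- S = S` off `V`; no change of the inverse over `xₙ ≤ S.axis 0 - 1`.
  obtain ⟨e, he, heU, g, heg, hg⟩ := exists_symplectic_push (m := m)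
    (U := O ∩ (S.toPerm.symm ⁻¹' V ∩ {q | S.axis 0 - 1 < q (Fin.last m, 0)}))
    (hO.inter ((hV.preimage S.symplectic.contDiff_symm.continuous).inter
      (isOpen_lt continuous_const (contDiff_coord _).continuous)))
    (a := S.axis 0) (b := S.axis 0 + 1) (by linarith) (by
      rintro _ ⟨s, hs, rfl⟩
      refine ⟨hLO ⟨s, S.axis_zero_nonneg.trans hs.1, rfl⟩, hLV ⟨S.axis.symm s, ?_, ?_⟩, ?_⟩
      · exact S.axis.le_symm_apply.2 hs.1
      · rw [Equiv.eq_symm_apply, S.apply_gamma0, S.axis.apply_symm_apply]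
      · simp only [mem_ofPred_eq, gamma0_last_zero]
        linarith [hs.1])
  refine ⟨⟨e * S.toPerm, he.mul S.symplectic, fun p hp => ?_, S.axis.trans g, fun s => ?_, ?_⟩,
    hg, fun p hp => ?_, fun q hq => ?_⟩
  · rw [Equiv.Perm.mul_apply, S.apply_of_notMem p hp, heU p fun h => hp h.1]
  · rw [Equiv.Perm.mul_apply, S.apply_gamma0, heg]; rfl
  · exact (add_nonneg S.axis_zero_nonneg zero_le_one).trans hg
  · refine heU _ fun h => hp ?_
    simpa using h.2.1
  · change S.toPerm.symm (e.symm q) = _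
    have : e q = q := heU _ fun h => (lt_of_lt_of_le h.2.2 hq).false
    rw [e.symm_apply_eq.2 this.symm]

/-- The ray can be excised by a symplectomorphism supported in a given neighbourhood of it. -/
theorem exists_symplectomorphism_spaceM1 {O : Set (PhaseSpace (m + 1))} (hO : IsOpen O)
    (hLO : rayL1 m ⊆ O) :
    ∃ φ : PhaseSpace (m + 1) → PhaseSpace (m + 1), IsSymplectomorphism φ (spaceM1 m) univ ∧
      ∀ p ∈ spaceM1 m, p ∉ O → φ p = p := by
  set V : ℕ → Set (PhaseSpace (m + 1)) := fun j => Metric.thickening (1 / ((j : ℝ) + 1)) (rayL1 m)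
    with hV
  have hVo : ∀ j, IsOpen (V j) := fun j => Metric.isOpen_thickening
  have hLV : ∀ j, rayL1 m ⊆ V j := fun j => Metric.self_subset_thickening (by positivity) _
  have hVanti : Antitone V := fun i j hij =>
    Metric.thickening_mono (one_div_le_one_div_of_le (by positivity) (by gcongr)) _
  have hVsep : ∀ p ∈ spaceM1 m, ∃ j, ∀ᶠ p' in 𝓝 p, p' ∉ V j := fun p hp => by
    obtain ⟨r, hr, hball⟩ := Metric.isOpen_iff.1 isOpen_spaceM1 p hp
    obtain ⟨j, hj⟩ := exists_nat_one_div_lt (half_pos hr)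
    refine ⟨j, ?_⟩
    filter_upwards [Metric.ball_mem_nhds p (half_pos hr)] with p' hp' hmem
    obtain ⟨z, hz, hzd⟩ := Metric.mem_thickening_iff.1 hmem
    refine hball ?_ hz
    rw [Metric.mem_ball] at hp' ⊢
    rw [dist_comm] at hzd
    linarith [dist_triangle z p' p]
  choose next hnext_axis hnext_V hnext_symm using fun (j : ℕ) (S : AxisSymplectomorphism O) =>
    S.exists_next hO hLO (hVo j) (hLV j)
  let S : ℕ → AxisSymplectomorphism O := fun j =>
    Nat.rec ⟨1, .one, fun _ _ => rfl, OrderIso.refl ℝ, fun _ => rfl, le_rfl⟩ next j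
  have hS : ∀ j, S (j + 1) = next j (S j) := fun j => rfl
  have hax : ∀ j : ℕ, (j : ℝ) ≤ (S j).axis 0 := fun j => by
    induction j with
    | zero => simpa using (S 0).axis_zero_nonneg
    | succ j ih =>
      rw [hS]; push_cast
      linarith [hnext_axis j (S j)]
  have hSV : ∀ {i j p}, j ≤ i → p ∉ V j → (S i).toPerm p = (S j).toPerm p := fun {i j p} hij hp => by
    induction i, hij using Nat.le_induction with
    | base => rfl
    | succ i hij ih => rw [hS, hnext_V i (S i) p fun h => hp (hVanti hij h), ih]
  have hSq : ∀ {i j : ℕ} {q : PhaseSpace (m + 1)}, j ≤ i → q (Fin.last m, 0) ≤ (j : ℝ) - 1 →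
      (S i).toPerm.symm q = (S j).toPerm.symm q := fun {i j q} hij hq => by
    induction i, hij using Nat.le_induction with
    | base => rfl
    | succ i hij ih =>
      have : (j : ℝ) ≤ i := by exact_mod_cast hij
      rw [hS, hnext_symm i (S i) q (by linarith [hax i]), ih]
  -- `N p` and `M q` are stages from which the sequence is constant at `p` and its inverses at `q`;
  -- on the ray `N` is arbitrary.
  have hN : ∀ p, ∃ N, p ∈ spaceM1 m → p ∉ V N := fun p => by
    by_cases hp : p ∈ spaceM1 m
    · obtain ⟨j, hj⟩ := hVsep p hp
      exact ⟨j, fun _ => hj.self_of_nhds⟩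
    · exact ⟨0, fun h => absurd h hp⟩
  choose N hN using hN
  have hM : ∀ q : PhaseSpace (m + 1), ∃ M : ℕ, q (Fin.last m, 0) ≤ (M : ℝ) - 1 := fun q => by
    obtain ⟨M, hM⟩ := exists_nat_ge (q (Fin.last m, 0) + 1)
    exact ⟨M, by linarith⟩
  choose M hM using hM
  set φ : PhaseSpace (m + 1) → PhaseSpace (m + 1) := fun p => (S (N p)).toPerm p with hφ
  set ψ : PhaseSpace (m + 1) → PhaseSpace (m + 1) := fun q => (S (M q)).toPerm.symm q with hψ
  have hφV : ∀ {j p}, p ∉ V j → φ p = (S j).toPerm p := fun {j p} hp => by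
    have hpM : p ∈ spaceM1 m := fun h => hp (hLV j h)
    rw [hφ, ← hSV (le_max_left j (N p)) hp, hSV (le_max_right j (N p)) (hN p hpM)]
  have hψq : ∀ {j : ℕ} {q : PhaseSpace (m + 1)}, q (Fin.last m, 0) ≤ (j : ℝ) - 1 →
      ψ q = (S j).toPerm.symm q := fun {j q} hq => by
    rw [hψ, ← hSq (le_max_left j (M q)) hq, hSq (le_max_right j (M q)) (hM q)]
  have hφM : ∀ {p j}, p ∈ spaceM1 m → N p ≤ j → φ p = (S j).toPerm p := fun hp hj =>
    hφV fun h => hN _ hp (hVanti hj h)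
  have hψM : ∀ {q j}, M q ≤ j → ψ q = (S j).toPerm.symm q := fun {q j} hj => by
    have : (M q : ℝ) ≤ j := by exact_mod_cast hj
    exact hψq (by linarith [hM q])
  -- A point of the ray is sent by `S (M q)` to a point with `xₙ ≥ M q`, whereas `q` has `xₙ ≤ M q -
  -- 1`.
  have hψmaps : ∀ q, ψ q ∈ spaceM1 m := by
    rintro q ⟨s, hs : 0 ≤ s, hsq⟩
    have h1 : q = gamma0 m ((S (M q)).axis s) := by
      rw [← (S (M q)).apply_gamma0, hsq, hψ, Equiv.apply_symm_apply]
    have h2 := hM q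
    have h3 : q (Fin.last m, 0) = (S (M q)).axis s := by
      conv_lhs => rw [h1]
      exact gamma0_last_zero _
    linarith [hax (M q), (S (M q)).axis.monotone hs]
  have hφev : ∀ p ∈ spaceM1 m, ∃ j, φ =ᶠ[𝓝 p] (S j).toPerm := fun p hp => by
    obtain ⟨j, hj⟩ := hVsep p hp
    exact ⟨j, hj.mono fun p' hp' => hφV hp'⟩
  refine ⟨φ, ⟨isOpen_spaceM1, isOpen_univ, fun p hp => ?_,
    ⟨ψ, mapsTo_univ _ _, fun q _ => hψmaps q, ⟨fun p hp => ?_, fun q _ => ?_⟩, fun q _ => ?_⟩,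
    fun p hp u v => ?_⟩, fun p _ hpO => (S (N p)).apply_of_notMem p hpO⟩
  · obtain ⟨j, hj⟩ := hφev p hp
    exact ((S j).symplectic.contDiff.contDiffAt.congr_of_eventuallyEq hj).contDiffWithinAt
  · obtain ⟨j, hNj, hMj⟩ : ∃ j, N p ≤ j ∧ M (φ p) ≤ j := ⟨_, le_max_left _ _, le_max_right _ _⟩
    rw [hψM hMj, hφM hp hNj, Equiv.symm_apply_apply]
  · obtain ⟨j, hNj, hMj⟩ : ∃ j, N (ψ q) ≤ j ∧ M q ≤ j := ⟨_, le_max_left _ _, le_max_right _ _⟩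
    rw [hφM (hψmaps q) hNj, hψM hMj, Equiv.apply_symm_apply]
  · have hev : ψ =ᶠ[𝓝 q] (S (M q + 1)).toPerm.symm := by
      have : ∀ᶠ q' : PhaseSpace (m + 1) in 𝓝 q, q' (Fin.last m, 0) < (M q : ℝ) :=
        (contDiff_coord _).continuous.continuousAt.eventually_lt_const (by linarith [hM q])
      filter_upwards [this] with q' hq'
      exact hψq (j := M q + 1) (by push_cast; linarith)
    exact ((S (M q + 1)).symplectic.contDiff_symm.contDiffAt.congr_of_eventuallyEq hev).contDiffWithinAt
  · obtain ⟨j, hj⟩ := hφev p hp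
    rw [hj.fderiv_eq]
    exact (S j).symplectic.omega0_fderiv p u v

end Excision

/-- Here `n = m + 1` ranges over all integers `n ≥ 1`. -/
theorem theorem1p1 (m : ℕ) :
    IsStandard (spaceM1 m) ∧
    ∀ ε : ℝ, 0 < ε →
      ∃ φ : PhaseSpace (m + 1) → PhaseSpace (m + 1),
        IsSymplectomorphism φ (spaceM1 m) Set.univ ∧
        ∀ p ∈ spaceM1 m, p ∉ rayNbhd m ε → φ p = p := by
  have key : ∀ ε : ℝ, 0 < ε → ∃ φ : PhaseSpace (m + 1) → PhaseSpace (m + 1),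
      IsSymplectomorphism φ (spaceM1 m) Set.univ ∧
        ∀ p ∈ spaceM1 m, p ∉ rayNbhd m ε → φ p = p := fun ε hε =>
    exists_symplectomorphism_spaceM1 (isOpen_rayNbhd ε) (rayL1_subset_rayNbhd hε)
  obtain ⟨φ, hφ, -⟩ := key 1 one_pos
  exact ⟨⟨isOpen_spaceM1, φ, hφ⟩, key⟩
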